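/- Let $d\ge 0$ be an integer, let $\mathbb{R}^d$ carry the Euclidean metric, and let $\Delta=\{(u,v)\in\mathbb{R}^2: v\le u\}$. For a non-empty set $X\subset\mathbb{R}^d$, let $B(x,R)$ denote the closed ball of radius $R$ centred at $x$ in the metric space $X$, and for $E\subset X$ and $r>0$ let $P_r(E)$ denote the maximal cardinality of a subset of $E$ whose distinct points are at distance strictly larger than $4r$. The infimal two-scale branching function of $X$ is $$\underline{\beta}_X(u,v)=\log_2\inf_{x\in X}P_{2^{-u}}\bigl(B(x,2^{-v})\bigr),\qquad (u,v)\in\Delta.$$ Let $\mathcal{L}(d)$ denote the set of functions $f\colon\Delta\to[0,\infty)$ such that $f(u,u)=0$ for all $u$, $f(u,v)\ge f(u,w)+f(w,v)$ for all $v\le w\le u$, and for each $v\in\mathbb{R}$ the function $u\mapsto f(u,v)$ is $d$-Lipschitz on $[v,\infty)$. For $f,g\colon\Delta\to[0,\infty)$, write $f\sim_d g$ if there is a constant $z\ge 0$ depending only on $d$ such that for all $0\le v\le u$, $$f(u,v+z)-z\le g(u,v)\ \text{ whenever } v\le u-z,\qquad\text{and}\qquad g(u,v)\le f(u,v-z)+z\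 \text{ whenever } v\ge z.$$ Then the following hold. (i) For every non-empty set $X\subset\mathbb{R}^d$, the function $\underline{\beta}_X$ takes values in $[0,\infty)$ and there is a function $f\in\mathcal{L}(d)$ such that $f\sim_d\underline{\beta}_X$. (ii) For every $f\in\mathcal{L}(d)$ there is a non-empty compact set $X\subset\mathbb{R}^d$ such that $f\sim_d\underline{\beta}_X$. In both parts the constant $z$ depends only on $d$, and not on $X$ or $f$. -/

import Mathlib

open scoped NNReal ENNReal

noncomputable section

/-- `P_r(E)`: the maximal cardinality of a subset of `E` whose distinct points are at distance
strictly larger than `4 r`. -/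
def strongPacking {Y : Type*} [MetricSpace Y] (r : ℝ≥0) (E : Set Y) : ℕ∞ :=
  Metric.packingNumber (4 * r) E

/-- The logarithm in base `2` on `[0, ∞]`, with values `-∞` at `0` and `∞` at `∞`. -/
def extLogTwo (t : ℝ≥0∞) : EReal :=
  ENNReal.log t / ((Real.log 2 : ℝ) : EReal)

/-- The infimal two-scale branching function of a subset `X` of a metric space, with the metric
induced on `X` (so that balls are intersected with `X`):
`(u, v) ↦ log₂ inf_{x ∈ X} P_{2^{-u}}(B(x, 2^{-v}))`, `B` a closed ball. It is meant for `v ≤ u`.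
The infimum over the empty set is `∞`. -/
def lowerBranching {Y : Type*} [MetricSpace Y] (X : Set Y) (u v : ℝ) : EReal :=
  extLogTwo
    ((⨅ x ∈ X, strongPacking ((2 : ℝ≥0) ^ (-u)) (X ∩ Metric.closedBall x ((2 : ℝ) ^ (-v))) : ℕ∞) :
      ℝ≥0∞)

/-- The class `𝓛(α)` of functions `f : Δ → [0, ∞)`, where `Δ = {(u, v) : v ≤ u}`. A function on `Δ`
is represented by `f : ℝ → ℝ → ℝ`, of which only the values `f u v` with `v ≤ u` matter. -/
structure MemL (α : ℝ≥0) (f : ℝ → ℝ → ℝ) : Prop where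
  nonneg : ∀ u v : ℝ, v ≤ u → 0 ≤ f u v
  diag : ∀ u : ℝ, f u u = 0
  superadd : ∀ u w v : ℝ, v ≤ w → w ≤ u → f u w + f w v ≤ f u v
  lipschitz : ∀ v : ℝ, LipschitzOnWith α (fun u => f u v) (Set.Ici v)

/-- `f ∼ g` with constant `z`, for functions `f, g : Δ → [0, ∞)`. The functions are given with
extended real values, and it is part of the relation that on `Δ` they take values in `[0, ∞)`. -/
structure SimWith (z : ℝ) (f g : ℝ → ℝ → EReal) : Prop where
  left_range : ∀ u v : ℝ, v ≤ u → 0 ≤ f u v ∧ f u v < ⊤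
  right_range : ∀ u v : ℝ, v ≤ u → 0 ≤ g u v ∧ g u v < ⊤
  lower : ∀ u v : ℝ, 0 ≤ v → v ≤ u → v ≤ u - z → f u (v + z) - (z : EReal) ≤ g u v
  upper : ∀ u v : ℝ, 0 ≤ v → v ≤ u → z ≤ v → g u v ≤ f u (v - z) + (z : EReal)

end

/-! Write β for the branching function. For (i), β is nearly in `MemL d`. Volume bounds give `β u v
≤ β w v + d(u - w) + 2d`, and nesting separated sets at successive scales shows that sums of β over
disjoint scale intervals of length at least 2 are at most β on a slightly larger interval
(`IntervalChain.le_branching`). The supremum of such sums is superadditive, and its largest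
`d`-Lipschitz minorant in the first variable stays superadditive; both operations cost only a
bounded amount depending on `d`.

For (ii), fixing `n` and freeing binary digits at the rate of the increments of `⌊f j n⌋` gives a
homogeneous set whose branching between scales m and k is about `f k n - f m n`. By superadditivity
this is at least `f k m` for every `n ≤ m`, with equality at `n = m`. So `cornerUnion` takes one
such piece for every `n`, of diameter about `2 ^ (-n)` and accumulating at 0. Every ball contains
enough points (`exists_finset_cornerUnion`), and a ball of radius slightly below `2 ^ (-n)` about
the corner of piece `n` sees that piece alone (`add_cornerShift_mem_of_dist_lt`), so the infimum is
no larger than it should be. -/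

/-! ### Separated sets and the volume bound. -/

/-- The points of `C` are at mutual distance larger than `r`. -/
def Separated {Y : Type*} [MetricSpace Y] (r : ℝ) (C : Finset Y) : Prop :=
  (C : Set Y).Pairwise fun x y => r < dist x y

theorem Separated.mono {Y : Type*} [MetricSpace Y] {r s : ℝ} {C : Finset Y} (h : Separated s C)
    (hrs : r ≤ s) : Separated r C :=
  fun _ hx _ hy hxy => hrs.trans_lt (h hx hy hxy)

theorem Separated.subset {Y : Type*} [MetricSpace Y] {r : ℝ} {C D : Finset Y} (h : Separated r D)
    (hCD : C ⊆ D) : Separated r C :=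
  fun _ hx _ hy hxy => h (hCD hx) (hCD hy) hxy

theorem separated_singleton {Y : Type*} [MetricSpace Y] (r : ℝ) (x : Y) :
    Separated r ({x} : Finset Y) := by
  simp [Separated]

/-- The volume bound for separated subsets of balls. -/
theorem Separated.card_le {d : ℕ} {C : Finset (EuclideanSpace ℝ (Fin d))}
    {x : EuclideanSpace ℝ (Fin d)} {R ε : ℝ} (h : Separated ε C) (hε : 0 < ε) (hR : 0 ≤ R)
    (hC : ∀ c ∈ C, dist c x ≤ R) : (C.card : ℝ) ≤ (1 + 2 * R / ε) ^ d := by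
  classical
  let μ : MeasureTheory.Measure (EuclideanSpace ℝ (Fin d)) := MeasureTheory.volume
  have hδ : 0 < ε / 2 := by positivity
  have hρ : 0 < R + ε / 2 := by positivity
  have hfin : Module.finrank ℝ (EuclideanSpace ℝ (Fin d)) = d := by simp
  have D : Set.Pairwise (C : Set (EuclideanSpace ℝ (Fin d)))
      (Function.onFun Disjoint fun c => Metric.ball c (ε / 2)) := by
    intro c hc e he hce
    apply Metric.ball_disjoint_ball
    have := h hc he hce
    linarith
  have A_subset : (⋃ c ∈ C, Metric.ball c (ε / 2)) ⊆ Metric.ball x (R + ε / 2) := by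
    refine Set.iUnion₂_subset fun c hc => ?_
    apply Metric.ball_subset_ball'
    linarith [hC c hc]
  have I : (C.card : ℝ≥0∞) * ENNReal.ofReal ((ε / 2) ^ d) * μ (Metric.ball 0 1) ≤
      ENNReal.ofReal ((R + ε / 2) ^ d) * μ (Metric.ball 0 1) :=
    calc
      (C.card : ℝ≥0∞) * ENNReal.ofReal ((ε / 2) ^ d) * μ (Metric.ball 0 1)
          = μ (⋃ c ∈ C, Metric.ball c (ε / 2)) := by
        rw [MeasureTheory.measure_biUnion_finset D fun c _ => measurableSet_ball]
        simp only [μ.addHaar_ball_of_pos _ hδ, hfin]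
        simp only [Finset.sum_const, nsmul_eq_mul, mul_assoc]
      _ ≤ μ (Metric.ball x (R + ε / 2)) := MeasureTheory.measure_mono A_subset
      _ = ENNReal.ofReal ((R + ε / 2) ^ d) * μ (Metric.ball 0 1) := by
        simp only [μ.addHaar_ball_of_pos _ hρ, hfin]
  have J : (C.card : ℝ≥0∞) * ENNReal.ofReal ((ε / 2) ^ d) ≤ ENNReal.ofReal ((R + ε / 2) ^ d) :=
    (ENNReal.mul_le_mul_iff_left (Metric.measure_ball_pos _ _ zero_lt_one).ne'
      MeasureTheory.measure_ball_lt_top.ne).1 I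
  have K := ENNReal.toReal_le_of_le_ofReal (by positivity) J
  rw [ENNReal.toReal_mul, ENNReal.toReal_natCast, ENNReal.toReal_ofReal (by positivity)] at K
  have e : 1 + 2 * R / ε = (R + ε / 2) / (ε / 2) := by field_simp; ring
  rw [e, div_pow, le_div_iff₀ (by positivity)]
  exact K

theorem isSeparated_iff_separated {Y : Type*} [MetricSpace Y] (u : ℝ) (C : Finset Y) :
    Metric.IsSeparated ((4 * (2 : ℝ≥0) ^ (-u) : ℝ≥0) : ℝ≥0∞) (C : Set Y) ↔
      Separated (4 * (2 : ℝ) ^ (-u)) C := by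
  unfold Metric.IsSeparated Separated
  refine forall₅_congr fun x _ y _ _ => ?_
  beta_reduce
  rw [edist_nndist, ENNReal.coe_lt_coe, ← NNReal.coe_lt_coe, coe_nndist]
  push_cast
  rfl

/-! ### The real-valued branching function and its almost Lipschitz bound. -/

section branchingNumber

variable {d : ℕ}

/-- The number whose logarithm is the infimal two-scale branching function. -/
noncomputable def branchingNumber (X : Set (EuclideanSpace ℝ (Fin d))) (u v : ℝ) : ℕ :=
  (⨅ x ∈ X, strongPacking ((2 : ℝ≥0) ^ (-u)) (X ∩ Metric.closedBall x ((2 : ℝ) ^ (-v)))).toNat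

theorem strongPacking_ball_ne_top (X : Set (EuclideanSpace ℝ (Fin d)))
    (x : EuclideanSpace ℝ (Fin d)) (u v : ℝ) :
    strongPacking ((2 : ℝ≥0) ^ (-u)) (X ∩ Metric.closedBall x ((2 : ℝ) ^ (-v))) ≠ ⊤ := by
  classical
  intro h
  obtain ⟨N, hN⟩ := exists_nat_gt ((1 + 2 * (2 : ℝ) ^ (-v) / (4 * (2 : ℝ) ^ (-u))) ^ d)
  have h1 : (N : ℕ∞) < strongPacking ((2 : ℝ≥0) ^ (-u))
      (X ∩ Metric.closedBall x ((2 : ℝ) ^ (-v))) := by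
    rw [h]; exact ENat.natCast_lt_top N
  unfold strongPacking Metric.packingNumber at h1
  simp only [lt_iSup_iff] at h1
  obtain ⟨C, hC, hsep, hcard⟩ := h1
  obtain ⟨D, hDC, hD⟩ := Set.exists_subset_encard_eq hcard.le
  have hfin : D.Finite := Set.finite_of_encard_eq_coe hD
  lift D to Finset (EuclideanSpace ℝ (Fin d)) using hfin
  have hs := (isSeparated_iff_separated u D).1 (hsep.subset hDC)
  have := hs.card_le (x := x) (R := (2 : ℝ) ^ (-v)) (by positivity) (by positivity)
    fun c hc => (hC (hDC hc)).2
  rw [Set.encard_coe_eq_coe_finsetCard, Nat.cast_inj] at hD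
  rw [hD] at this
  linarith

variable {X : Set (EuclideanSpace ℝ (Fin d))}

theorem coe_branchingNumber (hX : X.Nonempty) (u v : ℝ) :
    (branchingNumber X u v : ℕ∞) =
      ⨅ x ∈ X, strongPacking ((2 : ℝ≥0) ^ (-u)) (X ∩ Metric.closedBall x ((2 : ℝ) ^ (-v))) := by
  obtain ⟨x, hx⟩ := hX
  exact ENat.natCast_toNat (ne_top_of_le_ne_top (strongPacking_ball_ne_top X x u v) (iInf₂_le x hx))

theorem exists_separated_card_eq {x : EuclideanSpace ℝ (Fin d)} (hx : x ∈ X) (u v : ℝ) :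
    ∃ C : Finset (EuclideanSpace ℝ (Fin d)), (∀ c ∈ C, c ∈ X ∧ dist c x ≤ (2 : ℝ) ^ (-v)) ∧
      Separated (4 * (2 : ℝ) ^ (-u)) C ∧ C.card = branchingNumber X u v := by
  classical
  obtain ⟨C, hC, hfin, hsep, hcard⟩ :=
    Metric.exists_set_encard_eq_packingNumber (strongPacking_ball_ne_top X x u v)
  have h1 : (branchingNumber X u v : ℕ∞) ≤ C.encard := by
    rw [hcard, coe_branchingNumber ⟨x, hx⟩]
    exact iInf₂_le x hx
  obtain ⟨D, hDC, hD⟩ := Set.exists_subset_encard_eq h1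
  have hfin : D.Finite := Set.finite_of_encard_eq_coe hD
  lift D to Finset (EuclideanSpace ℝ (Fin d)) using hfin
  refine ⟨D, fun c hc => hC (hDC hc), (isSeparated_iff_separated u D).1 (hsep.subset hDC), ?_⟩
  rwa [Set.encard_coe_eq_coe_finsetCard, Nat.cast_inj] at hD

/-- An infimum of extended naturals is attained, so a single centre bounds all separated sets in its
ball. -/
theorem exists_forall_card_le (hX : X.Nonempty) (u v : ℝ) :
    ∃ x ∈ X, ∀ C : Finset (EuclideanSpace ℝ (Fin d)),
      (∀ c ∈ C, c ∈ X ∧ dist c x ≤ (2 : ℝ) ^ (-v)) →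
      Separated (4 * (2 : ℝ) ^ (-u)) C → C.card ≤ branchingNumber X u v := by
  have h : (⨅ x ∈ X, strongPacking ((2 : ℝ≥0) ^ (-u))
      (X ∩ Metric.closedBall x ((2 : ℝ) ^ (-v)))) < (branchingNumber X u v + 1 : ℕ) := by
    rw [← coe_branchingNumber hX]
    exact_mod_cast Nat.lt_succ_self _
  simp only [iInf_lt_iff] at h
  obtain ⟨x, hx, h⟩ := h
  refine ⟨x, hx, fun C hC hsep => ?_⟩
  have h2 := Metric.IsSeparated.encard_le_packingNumber
    (A := X ∩ Metric.closedBall x ((2 : ℝ) ^ (-v))) (fun c hc => hC c hc)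
    ((isSeparated_iff_separated u C).2 hsep)
  rw [Set.encard_coe_eq_coe_finsetCard] at h2
  have h3 := h2.trans_lt h
  rw [Nat.cast_lt] at h3
  omega

theorem le_branchingNumber {u v : ℝ} {n : ℕ} (hX : X.Nonempty)
    (h : ∀ x ∈ X, ∃ C : Finset (EuclideanSpace ℝ (Fin d)),
      (∀ c ∈ C, c ∈ X ∧ dist c x ≤ (2 : ℝ) ^ (-v)) ∧
        Separated (4 * (2 : ℝ) ^ (-u)) C ∧ n ≤ C.card) : n ≤ branchingNumber X u v := by
  obtain ⟨x, hx, hmax⟩ := exists_forall_card_le hX u v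
  obtain ⟨C, hC, hsep, hn⟩ := h x hx
  exact hn.trans (hmax C hC hsep)

theorem one_le_branchingNumber (hX : X.Nonempty) (u v : ℝ) : 1 ≤ branchingNumber X u v :=
  le_branchingNumber hX fun x hx => ⟨{x}, by
    simp only [Finset.mem_singleton, forall_eq, dist_self]; exact ⟨hx, by positivity⟩,
    separated_singleton _ _, by simp⟩

/-- The infimal branching function as a real valued function. -/
noncomputable def branching (X : Set (EuclideanSpace ℝ (Fin d))) (u v : ℝ) : ℝ :=
  Real.logb 2 (branchingNumber X u v)

theorem branching_nonneg (X : Set (EuclideanSpace ℝ (Fin d))) (u v : ℝ) : 0 ≤ branching X u v := by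
  unfold branching Real.logb
  positivity

theorem lowerBranching_eq (hX : X.Nonempty) (u v : ℝ) :
    lowerBranching X u v = (branching X u v : EReal) := by
  have h1 := one_le_branchingNumber hX u v
  unfold lowerBranching extLogTwo
  rw [← coe_branchingNumber hX, ENat.toENNReal_coe, branching, Real.logb,
    ENNReal.log_pos_real (by simp; omega) (by simp), ENNReal.toReal_natCast, EReal.coe_div]

theorem le_branching_of_rpow_le (hX : X.Nonempty) {u v s : ℝ}
    (h : (2 : ℝ) ^ s ≤ branchingNumber X u v) : s ≤ branching X u v := by
  have h1 : (0 : ℝ) < branchingNumber X u v := by exact_mod_cast one_le_branchingNumber hX u v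
  rwa [branching, Real.le_logb_iff_rpow_le (by norm_num) h1]

theorem rpow_branching (hX : X.Nonempty) (u v : ℝ) :
    (2 : ℝ) ^ branching X u v = branchingNumber X u v := by
  have h1 : (0 : ℝ) < branchingNumber X u v := by exact_mod_cast one_le_branchingNumber hX u v
  rw [branching, Real.rpow_logb (by norm_num) (by norm_num) h1]

theorem branching_le_of_le_rpow (hX : X.Nonempty) {u v s : ℝ}
    (h : branchingNumber X u v ≤ (2 : ℝ) ^ s) : branching X u v ≤ s := by
  have h1 : (0 : ℝ) < branchingNumber X u v := by exact_mod_cast one_le_branchingNumber hX u v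
  rwa [branching, Real.logb_le_iff_le_rpow (by norm_num) h1]

theorem branching_anti (hX : X.Nonempty) (u : ℝ) {v w : ℝ} (hvw : v ≤ w) :
    branching X u w ≤ branching X u v := by
  apply le_branching_of_rpow_le hX
  rw [rpow_branching hX, Nat.cast_le]
  refine le_branchingNumber hX fun x hx => ?_
  obtain ⟨C, hC, hsep, hn⟩ := exists_separated_card_eq hx u w
  refine ⟨C, fun c hc => ⟨(hC c hc).1, (hC c hc).2.trans ?_⟩, hsep, hn.ge⟩
  exact Real.rpow_le_rpow_of_exponent_le (by norm_num) (by linarith)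

/-- Around a centre extremal at scale w, a maximal packing is also a cover. Points separated at the
finer scale u are grouped by covering ball, and each group is bounded by volume. -/
theorem branching_le_add (hX : X.Nonempty) {u w : ℝ} (v : ℝ) (hwu : w ≤ u) :
    branching X u v ≤ branching X w v + d * (u - w) + 2 * d := by
  classical
  obtain ⟨x, hx, hmax⟩ := exists_forall_card_le hX w v
  obtain ⟨C, hC, hCsep, hCn⟩ := exists_separated_card_eq hx w v
  obtain ⟨D, hD, hDsep, hDn⟩ := exists_separated_card_eq hx u v
  have hcov : ∀ y ∈ D, ∃ c ∈ C, dist y c ≤ 4 * (2 : ℝ) ^ (-w) := by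
    intro y hy
    by_contra! hcon
    have hyC : y ∉ C := by
      intro hyC
      have := hcon y hyC
      rw [dist_self] at this
      exact absurd this (not_lt.2 (by positivity))
    have := hmax (insert y C) (by
      intro c hc
      rcases Finset.mem_insert.1 hc with rfl | hc
      · exact hD _ hy
      · exact hC _ hc) (by
      unfold Separated
      rw [Finset.coe_insert]
      refine hCsep.insert_of_notMem (by simpa using hyC) fun c hc => ?_
      have := hcon c hc
      exact ⟨this, by rwa [dist_comm]⟩)
    rw [Finset.card_insert_of_notMem hyC] at this
    omega
  choose! g hg hgd using hcov
  have hone : (1 : ℝ) ≤ 2 ^ (u - w) := Real.one_le_rpow (by norm_num) (by linarith)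
  have hfib : ∀ c ∈ C, ({y ∈ D | g y = c}.card : ℝ) ≤ (2 : ℝ) ^ (d * (u - w) + 2 * d) := by
    intro c _
    have h1 := (hDsep.subset (Finset.filter_subset (fun y => g y = c) D)).card_le (x := c)
      (R := 4 * (2 : ℝ) ^ (-w)) (by positivity) (by positivity) (by
        intro y hy
        rw [Finset.mem_filter] at hy
        rw [← hy.2]
        exact hgd y hy.1)
    refine h1.trans ?_
    have e1 : 2 * (4 * (2 : ℝ) ^ (-w)) / (4 * (2 : ℝ) ^ (-u)) = 2 * 2 ^ (u - w) := by
      rw [Real.rpow_sub (by norm_num), Real.rpow_neg (by norm_num), Real.rpow_neg (by norm_num)]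
      field_simp
    -- The error 2d comes from `1 + 2t ≤ 4t`, where `t = 2 ^ (u - w) ≥ 1`.
    have e2 : (2 : ℝ) ^ (d * (u - w) + 2 * d) = (2 ^ (u - w) * 4) ^ d := by
      have h4 : (4 : ℝ) = 2 ^ (2 : ℝ) := by norm_num
      rw [h4, ← Real.rpow_add (by norm_num), ← Real.rpow_mul_natCast (by norm_num)]
      congr 1
      ring
    rw [e1, e2]
    gcongr
    linarith
  apply branching_le_of_le_rpow hX
  calc (branchingNumber X u v : ℝ) = D.card := by rw [hDn]
    _ = ∑ c ∈ C, ({y ∈ D | g y = c}.card : ℝ) := by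
      rw [Finset.card_eq_sum_card_fiberwise (f := g) (t := C) (fun y hy => hg y hy)]
      push_cast
      rfl
    _ ≤ ∑ c ∈ C, (2 : ℝ) ^ (d * (u - w) + 2 * d) := Finset.sum_le_sum hfib
    _ = (2 : ℝ) ^ (branching X w v + d * (u - w) + 2 * d) := by
      rw [Finset.sum_const, nsmul_eq_mul, hCn, add_assoc, Real.rpow_add (by norm_num) (branching X w v),
        rpow_branching hX]

/-- A ball has diameter at most twice its radius, below the factor 4 in the packing separation. -/
theorem branching_self (hX : X.Nonempty) (v : ℝ) : branching X v v = 0 := by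
  refine le_antisymm ?_ (branching_nonneg X v v)
  apply branching_le_of_le_rpow hX
  obtain ⟨x, hx⟩ := hX
  obtain ⟨C, hC, hsep, hn⟩ := exists_separated_card_eq hx v v
  rw [Real.rpow_zero, ← hn, Nat.cast_le_one, Finset.card_le_one]
  intro a ha b hb
  by_contra hab
  have h1 := hsep ha hb hab
  have h2 := dist_triangle_right a b x
  have h3 := (hC a ha).2
  have h4 := (hC b hb).2
  have : (0 : ℝ) < 2 ^ (-v) := by positivity
  linarith

theorem branching_le (hX : X.Nonempty) {u v : ℝ} (hvu : v ≤ u) :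
    branching X u v ≤ d * (u - v) + 2 * d := by
  simpa [branching_self hX] using branching_le_add hX v hvu

end branchingNumber

/-! ### Chains of scale intervals and almost superadditivity. -/

/-- `IntervalChain β u v s` says that `s` is the sum of the values of `β` at finitely many
non-overlapping subintervals of `[v, u]` of length at least `2`. -/
inductive IntervalChain (β : ℝ → ℝ → ℝ) (u : ℝ) : ℝ → ℝ → Prop
  | nil {v : ℝ} (h : v ≤ u) : IntervalChain β u v 0
  | cons {v a b s : ℝ} (hva : v ≤ a) (hab : a + 2 ≤ b) (h : IntervalChain β u b s) :
      IntervalChain β u v (β b a + s)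

namespace IntervalChain

variable {β : ℝ → ℝ → ℝ} {u v w s t : ℝ}

theorem le (h : IntervalChain β u v s) : v ≤ u := by
  induction h with
  | nil h => exact h
  | cons hva hab _ ih => linarith

theorem extend_left (h : IntervalChain β u w s) (hvw : v ≤ w) : IntervalChain β u v s := by
  cases h with
  | nil h => exact nil (hvw.trans h)
  | cons hva hab h => exact cons (hvw.trans hva) hab h

theorem append (h : IntervalChain β w v s) (h' : IntervalChain β u w t) :
    IntervalChain β u v (s + t) := by
  induction h with
  | nil h => rw [zero_add]; exact h'.extend_left h
  | cons hva hab _ ih => rw [add_assoc]; exact cons hva hab ih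

theorem eq_zero (h : IntervalChain β u u s) : s = 0 := by
  cases h with
  | nil h => rfl
  | cons hva hab h => have := h.le; linarith

/-- Each point of a packing for the first interval is replaced by a separated set for the remaining
chain. Intervals of length at least 2 shrink radii by at least 4, and `1 + (4/3)/4 = 4/3` closes the
induction. -/
theorem exists_separated {d : ℕ} {X : Set (EuclideanSpace ℝ (Fin d))} (hX : X.Nonempty)
    (h : IntervalChain (branching X) u v s) : ∀ x ∈ X, ∃ C : Finset (EuclideanSpace ℝ (Fin d)),
      (∀ c ∈ C, c ∈ X ∧ dist c x ≤ 4 / 3 * (2 : ℝ) ^ (-v)) ∧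
        Separated ((2 : ℝ) ^ (-u)) C ∧ (2 : ℝ) ^ s ≤ C.card := by
  classical
  induction h with
  | nil h =>
    intro x hx
    refine ⟨{x}, ?_, separated_singleton _ _, by simp⟩
    simp only [Finset.mem_singleton, forall_eq, dist_self]
    exact ⟨hx, by positivity⟩
  | @cons v a b s hva hab h ih =>
    intro x hx
    obtain ⟨C, hC, hCsep, hCn⟩ := exists_separated_card_eq hx b a
    choose! D hD hDsep hDn using ih
    have hb : (2 : ℝ) ^ (-b) ≤ 2 ^ (-a) / 4 := by
      rw [le_div_iff₀ (by norm_num), show (4 : ℝ) = 2 ^ (2 : ℝ) by norm_num,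
        ← Real.rpow_add (by norm_num)]
      exact Real.rpow_le_rpow_of_exponent_le (by norm_num) (by linarith)
    have hu : (2 : ℝ) ^ (-u) ≤ 2 ^ (-b) :=
      Real.rpow_le_rpow_of_exponent_le (by norm_num) (by linarith [h.le])
    have ha : (2 : ℝ) ^ (-a) ≤ 2 ^ (-v) :=
      Real.rpow_le_rpow_of_exponent_le (by norm_num) (by linarith)
    have hpos : (0 : ℝ) < 2 ^ (-b) := by positivity
    -- Centres are more than 4 units of `2 ^ (-b)` apart and each cluster has radius at most 4/3
    -- units; `4 - 8/3 > 1`.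
    have hsep : ∀ c ∈ C, ∀ e ∈ C, c ≠ e → ∀ y ∈ D c, ∀ z ∈ D e, (2 : ℝ) ^ (-b) < dist y z := by
      intro c hc e he hce y hy z hz
      have h1 := hCsep hc he hce
      have h2 := (hD c (hC c hc).1 y hy).2
      have h3 := (hD e (hC e he).1 z hz).2
      have h4 := dist_triangle4 c y z e
      rw [dist_comm c y] at h4
      linarith
    refine ⟨C.biUnion D, ?_, ?_, ?_⟩
    · intro y hy
      obtain ⟨c, hc, hy⟩ := Finset.mem_biUnion.1 hy
      have h1 := hD c (hC c hc).1 y hy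
      refine ⟨h1.1, ?_⟩
      have h2 := (hC c hc).2
      have h3 := dist_triangle y c x
      linarith [h1.2]
    · intro y hy z hz hyz
      obtain ⟨c, hc, hy⟩ := Finset.mem_biUnion.1 hy
      obtain ⟨e, he, hz⟩ := Finset.mem_biUnion.1 hz
      by_cases hce : c = e
      · subst hce
        exact hDsep c (hC c hc).1 hy hz hyz
      · exact hu.trans_lt (hsep c hc e he hce y hy z hz)
    · rw [Finset.card_biUnion]
      · push_cast
        rw [Real.rpow_add (by norm_num), rpow_branching hX, ← hCn, ← nsmul_eq_mul]
        exact Finset.card_nsmul_le_sum _ _ _ fun c hc => hDn c (hC c hc).1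
      · intro c hc e he hce
        refine Finset.disjoint_left.2 ?_
        intro y hy hy'
        have := hsep c hc e he hce y hy y hy'
        rw [dist_self] at this
        linarith

theorem le_branching {d : ℕ} {X : Set (EuclideanSpace ℝ (Fin d))} (hX : X.Nonempty)
    (h : IntervalChain (branching X) u v s) : s ≤ branching X (u + 2) (v - 1) := by
  obtain ⟨x, hx, hmax⟩ := exists_forall_card_le hX (u + 2) (v - 1)
  obtain ⟨C, hC, hsep, hn⟩ := h.exists_separated hX x hx
  have e1 : (2 : ℝ) ^ (-(v - 1)) = 2 * 2 ^ (-v) := by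
    rw [neg_sub, sub_eq_add_neg, Real.rpow_add (by norm_num), Real.rpow_one]
  have e2 : 4 * (2 : ℝ) ^ (-(u + 2)) = 2 ^ (-u) := by
    rw [neg_add, Real.rpow_add (by norm_num), Real.rpow_neg (by norm_num) 2]
    norm_num
    ring
  have hpos : (0 : ℝ) < 2 ^ (-v) := by positivity
  apply le_branching_of_rpow_le hX
  refine hn.trans ?_
  rw [Nat.cast_le]
  refine hmax C (fun c hc => ⟨(hC c hc).1, (hC c hc).2.trans ?_⟩) ?_
  · rw [e1]
    linarith
  · rwa [e2]

end IntervalChain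

/-- The largest superadditive function generated by the values of `β` on intervals of length at
least `2`. -/
noncomputable def superadditiveHull (β : ℝ → ℝ → ℝ) (u v : ℝ) : ℝ :=
  sSup {s | IntervalChain β u v s}

/-! ### Lipschitz regularisation preserving superadditivity. -/

/-- The largest `α`-Lipschitz minorant in the first variable. -/
noncomputable def lipschitzMinorant (α : ℝ) (f : ℝ → ℝ → ℝ) (u v : ℝ) : ℝ :=
  sInf ((fun w => f w v + α * (u - w)) '' Set.Icc v u)

section lipschitzMinorant

variable {α : ℝ≥0} {f : ℝ → ℝ → ℝ}

theorem lipschitzMinorant_le (hf : ∀ u v, v ≤ u → 0 ≤ f u v) {u v w : ℝ} (hvw : v ≤ w)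
    (hwu : w ≤ u) : lipschitzMinorant α f u v ≤ f w v + α * (u - w) := by
  refine csInf_le ⟨0, ?_⟩ ⟨w, ⟨hvw, hwu⟩, rfl⟩
  rintro _ ⟨t, ht, rfl⟩
  have := hf t v ht.1
  have := sub_nonneg.2 ht.2
  have := α.2
  beta_reduce
  positivity

theorem le_lipschitzMinorant {u v c : ℝ} (hvu : v ≤ u)
    (h : ∀ w, v ≤ w → w ≤ u → c ≤ f w v + α * (u - w)) : c ≤ lipschitzMinorant α f u v := by
  refine le_csInf ⟨_, v, ⟨le_rfl, hvu⟩, rfl⟩ ?_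
  rintro _ ⟨t, ht, rfl⟩
  exact h t ht.1 ht.2

theorem memL_lipschitzMinorant (hf : ∀ u v, v ≤ u → 0 ≤ f u v) (hdiag : ∀ u, f u u = 0)
    (hsup : ∀ u w v, v ≤ w → w ≤ u → f u w + f w v ≤ f u v) :
    MemL α (lipschitzMinorant α f) := by
  have hmono : ∀ {u w v}, v ≤ w → w ≤ u → f w v ≤ f u v := fun {u w v} h1 h2 => by
    linarith [hsup u w v h1 h2, hf u w h2]
  have hα : (0 : ℝ) ≤ α := α.coe_nonneg
  have hnonneg : ∀ u v, v ≤ u → 0 ≤ lipschitzMinorant α f u v := fun u v h =>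
    le_lipschitzMinorant h fun w h1 h2 => by
      have := hf w v h1
      have := sub_nonneg.2 h2
      positivity
  refine ⟨hnonneg, fun u => le_antisymm ?_ (hnonneg u u le_rfl), fun u w v hvw hwu => ?_,
    fun v => ?_⟩
  · have := lipschitzMinorant_le (α := α) hf (le_refl u) (le_refl u)
    simpa [hdiag] using this
  · refine le_lipschitzMinorant (hvw.trans hwu) fun t hvt htu => ?_
    rcases le_total w t with hwt | htw
    · have h1 := lipschitzMinorant_le (α := α) hf hwt htu
      have h2 := lipschitzMinorant_le (α := α) hf hvw (le_refl w)
      have h3 := hsup t w v hvw hwt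
      simp only [sub_self, mul_zero, add_zero] at h2
      linarith
    -- When the competitor t lies below w, the vanishing diagonal bounds the value at (u, w) by `α(u
    -- - w)`, which completes `α(w - t)` to `α(u - t)`.
    · have h1 := lipschitzMinorant_le (α := α) hf (le_refl w) hwu
      have h2 := lipschitzMinorant_le (α := α) hf hvt htw
      rw [hdiag] at h1
      linarith
  · have hle : ∀ {w u}, v ≤ w → w ≤ u →
        lipschitzMinorant α f w v ≤ lipschitzMinorant α f u v := fun {w u} h1 h2 =>
      le_lipschitzMinorant (h1.trans h2) fun t ht1 ht2 => by
        rcases le_total t w with htw | hwt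
        · have := lipschitzMinorant_le (α := α) hf ht1 htw
          nlinarith
        · have := lipschitzMinorant_le (α := α) hf h1 (le_refl w)
          have h3 := hmono h1 hwt
          have h4 := mul_nonneg hα (sub_nonneg.2 ht2)
          simp only [sub_self, mul_zero, add_zero] at this
          linarith
    have hlip : ∀ {w u}, v ≤ w → w ≤ u →
        lipschitzMinorant α f u v ≤ lipschitzMinorant α f w v + α * (u - w) :=
      fun {w u} h1 h2 => by
        rw [← sub_le_iff_le_add]
        exact le_lipschitzMinorant h1 fun t ht1 ht2 => by
          have := lipschitzMinorant_le (α := α) hf ht1 (ht2.trans h2)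
          linarith
    refine LipschitzOnWith.of_le_add_mul α fun x hx y hy => ?_
    rcases le_total x y with hxy | hyx
    · have := hle hx hxy
      have : 0 ≤ (α : ℝ) * dist x y := by positivity
      linarith
    · rw [Real.dist_eq, abs_of_nonneg (sub_nonneg.2 hyx)]
      exact hlip hy hyx

end lipschitzMinorant

theorem MemL.mono {α : ℝ≥0} {f : ℝ → ℝ → ℝ} (hf : MemL α f) {u w v : ℝ} (hvw : v ≤ w)
    (hwu : w ≤ u) : f w v ≤ f u v := by
  linarith [hf.superadd u w v hvw hwu, hf.nonneg u w hwu]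

theorem MemL.anti {α : ℝ≥0} {f : ℝ → ℝ → ℝ} (hf : MemL α f) {u w v : ℝ} (hvw : v ≤ w)
    (hwu : w ≤ u) : f u w ≤ f u v := by
  linarith [hf.superadd u w v hvw hwu, hf.nonneg w v hvw]

theorem MemL.le_add {α : ℝ≥0} {f : ℝ → ℝ → ℝ} (hf : MemL α f) {u w v : ℝ} (hvw : v ≤ w)
    (hwu : w ≤ u) : f u v ≤ f w v + α * (u - w) := by
  have := (hf.lipschitz v).dist_le_mul u (hvw.trans hwu) w hvw
  rw [Real.dist_eq, Real.dist_eq, abs_of_nonneg (sub_nonneg.2 hwu)] at this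
  linarith [le_abs_self (f u v - f w v)]

/-! ### Part (i): a function of the class close to a given branching function. -/

theorem exists_memL_simWith {d : ℕ} {X : Set (EuclideanSpace ℝ (Fin d))} (hX : X.Nonempty) :
    ∃ f : ℝ → ℝ → ℝ, MemL (d : ℝ≥0) f ∧
      SimWith (6 * d + 1) (fun u v => (f u v : EReal)) (lowerBranching X) := by
  set g := superadditiveHull (branching X) with hg
  have hd : (0 : ℝ) ≤ d := d.cast_nonneg
  have hbdd : ∀ u v, BddAbove {s | IntervalChain (branching X) u v s} := fun u v =>
    ⟨_, fun s hs => hs.le_branching hX⟩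
  have hle : ∀ {u v s}, IntervalChain (branching X) u v s → s ≤ g u v := fun {u v s} hs =>
    le_csSup (hbdd u v) hs
  have hge : ∀ {u v c}, v ≤ u → (∀ s, IntervalChain (branching X) u v s → s ≤ c) → g u v ≤ c :=
    fun {u v c} h hc => csSup_le ⟨0, .nil h⟩ hc
  have hnonneg : ∀ u v, v ≤ u → 0 ≤ g u v := fun u v h => hle (.nil h)
  have hdiag : ∀ u, g u u = 0 := fun u =>
    le_antisymm (hge le_rfl fun s hs => hs.eq_zero.le) (hnonneg u u le_rfl)
  have hsup : ∀ u w v, v ≤ w → w ≤ u → g u w + g w v ≤ g u v := by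
    intro u w v hvw hwu
    rw [← le_sub_iff_add_le]
    refine hge hwu fun s hs => ?_
    rw [le_sub_comm]
    refine hge hvw fun t ht => ?_
    rw [le_sub_iff_add_le]
    exact hle (ht.append hs)
  -- The chain bound overshoots u by 2, which costs `2d + 2d`.
  have hub : ∀ {u v}, v ≤ u → g u v ≤ branching X u (v - 1) + 4 * d := fun {u v} h =>
    hge h fun s hs => by
      have h1 := hs.le_branching hX
      have h2 := branching_le_add hX (v - 1) (show u ≤ u + 2 by linarith)
      linarith
  -- An interval of length at least 2 is itself a chain; on shorter ones the branching is at most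
  -- 4d.
  have hlb : ∀ {u v}, v ≤ u → branching X u v ≤ g u v + 4 * d := by
    intro u v h
    rcases le_total (v + 2) u with h2 | h2
    · have := hle (.cons (le_refl v) h2 (.nil (le_refl u)))
      linarith
    · have h3 := branching_le hX h
      have h4 := hnonneg u v h
      have h5 := mul_le_mul_of_nonneg_left (show u - v ≤ 2 by linarith) hd
      linarith
  have hmem := memL_lipschitzMinorant (α := (d : ℝ≥0)) hnonneg hdiag hsup
  refine ⟨_, hmem, ?_, ?_, ?_, ?_⟩
  · intro u v h
    exact ⟨EReal.coe_nonneg.2 (hmem.nonneg u v h), EReal.coe_lt_top _⟩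
  · intro u v h
    rw [lowerBranching_eq hX]
    exact ⟨EReal.coe_nonneg.2 (branching_nonneg X u v), EReal.coe_lt_top _⟩
  · intro u v _ _ h
    rw [lowerBranching_eq hX, ← EReal.coe_sub, EReal.coe_le_coe_iff]
    have h1 := lipschitzMinorant_le (α := (d : ℝ≥0)) hnonneg
      (show v + (6 * d + 1) ≤ u by linarith) (le_refl u)
    simp only [sub_self, mul_zero, add_zero] at h1
    have h2 := hub (show v + (6 * d + 1) ≤ u by linarith)
    have h3 := branching_anti hX u (show v ≤ v + (6 * d + 1) - 1 by linarith)
    linarith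
  · intro u v _ hvu _
    rw [lowerBranching_eq hX, ← EReal.coe_add, EReal.coe_le_coe_iff]
    have h1 := hmem.anti (show v - (6 * d + 1) ≤ v by linarith) hvu
    -- The loss 6d is 2d from the almost Lipschitz bound and 4d from passing to the hull.
    have h2 : branching X u v - 6 * d ≤ lipschitzMinorant (d : ℝ≥0) g u v :=
      le_lipschitzMinorant hvu fun w hvw hwu => by
        have h3 := branching_le_add hX v hwu
        have h4 := hlb hvw
        push_cast
        linarith
    linarith

/-! ### Separation of binary expansions. -/

theorem ofDigits_two_eq (x : ℕ → Fin 2) :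
    Real.ofDigits x = (x 0 : ℕ) * 2⁻¹ + 2⁻¹ * Real.ofDigits fun j => x (j + 1) := by
  rw [Real.ofDigits_eq_sum_add_ofDigits x 1]
  simp [Real.ofDigitsTerm]

theorem abs_ofDigits_sub_le_one_sub {k : ℕ} {x y : ℕ → Fin 2} (h : ∀ j, k ≤ j → x j = y j) :
    |Real.ofDigits x - Real.ofDigits y| ≤ 1 - ((2 : ℝ) ^ k)⁻¹ := by
  induction k generalizing x y with
  | zero =>
    have : x = y := funext fun j => h j j.zero_le
    simp [this]
  | succ k ih =>
    have h1 := ih (x := fun j => x (j + 1)) (y := fun j => y (j + 1))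
      fun j hj => h (j + 1) (by omega)
    rw [ofDigits_two_eq x, ofDigits_two_eq y, pow_succ, mul_inv]
    have hx : ((x 0 : ℕ) : ℝ) ≤ 1 := by exact_mod_cast Nat.lt_succ_iff.1 (x 0).2
    have hy : ((y 0 : ℕ) : ℝ) ≤ 1 := by exact_mod_cast Nat.lt_succ_iff.1 (y 0).2
    have hx' : (0 : ℝ) ≤ ((x 0 : ℕ) : ℝ) := by positivity
    have hy' : (0 : ℝ) ≤ ((y 0 : ℕ) : ℝ) := by positivity
    rw [abs_le] at h1 ⊢
    constructor <;> linarith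

/-- A common tail excludes the ambiguity of binary expansions: the difference is a nonzero multiple
of `2 ^ (-k)`. In the induction, differing first digits contribute 1/2 and the tails cancel at most
`(1 - 2 ^ (-k)) / 2` of it. -/
theorem le_abs_ofDigits_sub {k : ℕ} {x y : ℕ → Fin 2} (h : ∀ j, k ≤ j → x j = y j)
    (hne : x ≠ y) : ((2 : ℝ) ^ k)⁻¹ ≤ |Real.ofDigits x - Real.ofDigits y| := by
  induction k generalizing x y with
  | zero => exact absurd (funext fun j => h j j.zero_le) hne
  | succ k ih =>
    have hs : ∀ j, k ≤ j → x (j + 1) = y (j + 1) := fun j hj => h (j + 1) (by omega)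
    rw [ofDigits_two_eq x, ofDigits_two_eq y, pow_succ, mul_inv]
    by_cases h0 : x 0 = y 0
    · have h1 := ih (x := fun j => x (j + 1)) (y := fun j => y (j + 1)) hs fun he =>
        hne (funext fun j => by
          cases j with
          | zero => exact h0
          | succ j => exact congrFun he j)
      rw [h0, add_sub_add_left_eq_sub, ← mul_sub, abs_mul, abs_of_pos (by norm_num : (0 : ℝ) < 2⁻¹)]
      linarith
    · have h1 := abs_ofDigits_sub_le_one_sub (x := fun j => x (j + 1)) (y := fun j => y (j + 1)) hs
      rw [abs_le] at h1
      have hxy : ((x 0 : ℕ) : ℝ) = 0 ∧ ((y 0 : ℕ) : ℝ) = 1 ∨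
          ((x 0 : ℕ) : ℝ) = 1 ∧ ((y 0 : ℕ) : ℝ) = 0 := by
        generalize x 0 = a at *
        generalize y 0 = b at *
        fin_cases a <;> fin_cases b <;> simp at h0 ⊢
      rcases hxy with ⟨ha, hb⟩ | ⟨ha, hb⟩
      · rw [ha, hb, le_abs]
        right
        linarith
      · rw [ha, hb, le_abs]
        left
        linarith

/-! ### Homogeneous sets defined by free binary digits. -/

section digitSet

variable {d : ℕ}

/-- The crude factor `2 ^ d` replaces `√d`, so that comparing norms is a shift of scale by the
integer d. -/
theorem dist_le_two_pow_mul {x y : EuclideanSpace ℝ (Fin d)} {s : ℝ} (hs : 0 ≤ s)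
    (h : ∀ i, |x i - y i| ≤ s) : dist x y ≤ 2 ^ d * s := by
  rw [EuclideanSpace.dist_eq, Real.sqrt_le_iff]
  refine ⟨by positivity, ?_⟩
  calc ∑ i, dist (x i) (y i) ^ 2 ≤ ∑ _i : Fin d, s ^ 2 := by
        refine Finset.sum_le_sum fun i _ => ?_
        rw [Real.dist_eq]
        exact pow_le_pow_left₀ (abs_nonneg _) (h i) 2
    _ = d * s ^ 2 := by simp
    _ ≤ (2 ^ d * s) ^ 2 := by
        rw [mul_pow]
        have h1 : (d : ℝ) ≤ 2 ^ d := by exact_mod_cast Nat.lt_two_pow_self.le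
        have h2 : (1 : ℝ) ≤ 2 ^ d := one_le_pow₀ (by norm_num)
        have h3 : (d : ℝ) ≤ (2 ^ d) ^ 2 := by nlinarith
        gcongr

theorem abs_sub_apply_le_dist (x y : EuclideanSpace ℝ (Fin d)) (i : Fin d) :
    |x i - y i| ≤ dist x y := by
  rw [dist_eq_norm]
  exact PiLp.norm_apply_le (x - y) i

/-- The point with given binary digits of its coordinates. -/
noncomputable def ofBinary (ε : Fin d → ℕ → Fin 2) : EuclideanSpace ℝ (Fin d) :=
  WithLp.toLp 2 fun i => Real.ofDigits (ε i)

@[simp]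
theorem ofBinary_apply (ε : Fin d → ℕ → Fin 2) (i : Fin d) :
    ofBinary ε i = Real.ofDigits (ε i) := rfl

theorem continuous_ofBinary : Continuous (ofBinary (d := d)) := by
  refine (PiLp.continuous_toLp 2 _).comp (continuous_pi fun i => ?_)
  exact Real.continuous_ofDigits.comp (continuous_apply i)

/-- The points of the unit cube whose `j`-th binary digits vanish in the coordinates outside
`A j`. -/
def digitSet (A : ℕ → Finset (Fin d)) : Set (EuclideanSpace ℝ (Fin d)) :=
  ofBinary '' {ε | ∀ i j, i ∉ A j → ε i j = 0}

theorem isCompact_digitSet (A : ℕ → Finset (Fin d)) : IsCompact (digitSet A) := by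
  refine IsCompact.image (IsClosed.isCompact ?_) continuous_ofBinary
  simp only [Set.ofPred_forall]
  refine isClosed_iInter fun i => isClosed_iInter fun j => isClosed_iInter fun _ => ?_
  exact isClosed_eq ((continuous_apply j).comp (continuous_apply i)) continuous_const

theorem zero_mem_digitSet (A : ℕ → Finset (Fin d)) : 0 ∈ digitSet A := by
  refine ⟨fun _ _ => 0, fun _ _ _ => rfl, ?_⟩
  ext i
  simp [Real.ofDigits, Real.ofDigitsTerm]

theorem nonneg_of_mem_digitSet {A : ℕ → Finset (Fin d)} {x : EuclideanSpace ℝ (Fin d)}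
    (hx : x ∈ digitSet A) (i : Fin d) : 0 ≤ x i := by
  obtain ⟨ε, _, rfl⟩ := hx
  exact Real.ofDigits_nonneg _

theorem le_of_mem_digitSet {A : ℕ → Finset (Fin d)} {n : ℕ} (hA : ∀ j < n, A j = ∅)
    {x : EuclideanSpace ℝ (Fin d)} (hx : x ∈ digitSet A) (i : Fin d) :
    x i ≤ ((2 : ℝ) ^ n)⁻¹ := by
  obtain ⟨ε, hε, rfl⟩ := hx
  have h := Real.abs_ofDigits_sub_ofDigits_le (x := ε i) (y := fun _ => 0) (n := n)
    fun j hj => hε i j (by simp [hA j hj])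
  have h0 : Real.ofDigits (fun _ : ℕ => (0 : Fin 2)) = 0 := by
    simp [Real.ofDigits, Real.ofDigitsTerm]
  rw [h0, sub_zero] at h
  exact (le_abs_self _).trans (by exact_mod_cast h)

/-- The digits of the given point are kept except at positions in `[m, k)`, where the free ones are
chosen arbitrarily; the choices are indexed by subsets of `T`. The vector `p` allows for translated
copies. -/
theorem exists_finset_digitSet (A : ℕ → Finset (Fin d)) {x p : EuclideanSpace ℝ (Fin d)}
    (hx : x + p ∈ digitSet A) (m k : ℕ) :
    ∃ C : Finset (EuclideanSpace ℝ (Fin d)),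
      (∀ c ∈ C, c + p ∈ digitSet A ∧ ∀ i, |c i - x i| ≤ ((2 : ℝ) ^ m)⁻¹) ∧
      (∀ c ∈ C, ∀ c' ∈ C, c ≠ c' → ((2 : ℝ) ^ k)⁻¹ ≤ dist c c') ∧
      C.card = 2 ^ ∑ j ∈ Finset.Ico m k, (A j).card := by
  classical
  obtain ⟨ε, hε, hεx⟩ := hx
  set T : Finset (Σ _ : ℕ, Fin d) := (Finset.Ico m k).sigma A with hT
  let η : Finset (Σ _ : ℕ, Fin d) → Fin d → ℕ → Fin 2 := fun S i j =>
    if j ∈ Finset.Ico m k then (if (⟨j, i⟩ : Σ _ : ℕ, Fin d) ∈ S then 1 else 0) else ε i j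
  have hsep : ∀ S ∈ T.powerset, ∀ S' ∈ T.powerset, S ≠ S' →
      ((2 : ℝ) ^ k)⁻¹ ≤ dist (ofBinary (η S) - p) (ofBinary (η S') - p) := by
    intro S hS S' hS' hne
    rw [Finset.mem_powerset] at hS hS'
    obtain ⟨i, hi⟩ : ∃ i, η S i ≠ η S' i := by
      by_contra! hcon
      refine hne (Finset.ext fun ⟨j, i⟩ => ?_)
      by_cases hj : j ∈ Finset.Ico m k
      · have := congrFun (hcon i) j
        simp only [η, if_pos hj] at this
        split_ifs at this with h1 h2 h2 <;> simp_all
      · have hn : (⟨j, i⟩ : Σ _ : ℕ, Fin d) ∉ T := fun h => hj (Finset.mem_sigma.1 h).1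
        exact ⟨fun h => absurd (hS h) hn, fun h => absurd (hS' h) hn⟩
    rw [dist_sub_right]
    refine (le_abs_ofDigits_sub (fun j hj => ?_) hi).trans
      (abs_sub_apply_le_dist (ofBinary (η S)) (ofBinary (η S')) i)
    have : j ∉ Finset.Ico m k := by
      rw [Finset.mem_Ico]
      omega
    simp only [η, if_neg this]
  have hpos : (0 : ℝ) < ((2 : ℝ) ^ k)⁻¹ := by positivity
  refine ⟨T.powerset.image fun S => ofBinary (η S) - p, ?_, ?_, ?_⟩
  · intro c hc
    obtain ⟨S, hS, rfl⟩ := Finset.mem_image.1 hc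
    rw [Finset.mem_powerset] at hS
    rw [sub_add_cancel]
    refine ⟨⟨η S, fun i j hij => ?_, rfl⟩, fun i => ?_⟩
    · by_cases hj : j ∈ Finset.Ico m k
      · have hn : (⟨j, i⟩ : Σ _ : ℕ, Fin d) ∉ S := fun h => hij (Finset.mem_sigma.1 (hS h)).2
        simp only [η, if_pos hj, if_neg hn]
      · simp only [η, if_neg hj]
        exact hε i j hij
    · have e1 : (ofBinary (η S) - p) i - x i = ofBinary (η S) i - ofBinary ε i := by
        rw [hεx, PiLp.sub_apply, PiLp.add_apply]
        ring
      rw [e1]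
      have := Real.abs_ofDigits_sub_ofDigits_le (x := η S i) (y := ε i) (n := m) fun j hj => by
        have : j ∉ Finset.Ico m k := by
          rw [Finset.mem_Ico]
          omega
        simp only [η, if_neg this]
      exact_mod_cast this
  · intro c hc c' hc' hne
    obtain ⟨S, hS, rfl⟩ := Finset.mem_image.1 hc
    obtain ⟨S', hS', rfl⟩ := Finset.mem_image.1 hc'
    exact hsep S hS S' hS' fun h => hne (by rw [h])
  · rw [Finset.card_image_of_injOn, Finset.card_powerset, hT, Finset.card_sigma]
    intro S hS S' hS' he
    by_contra hne
    have := hsep S hS S' hS' hne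
    rw [show ofBinary (η S) - p = ofBinary (η S') - p from he, dist_self] at this
    linarith

/-- Points with the same first k digits in every coordinate are too close to be separated, so the
free digits before k determine the point. -/
theorem card_le_of_subset_digitSet (A : ℕ → Finset (Fin d)) {p : EuclideanSpace ℝ (Fin d)}
    {C : Finset (EuclideanSpace ℝ (Fin d))} (hC : ∀ c ∈ C, c + p ∈ digitSet A) {k : ℕ}
    (hsep : Separated (2 ^ d * ((2 : ℝ) ^ k)⁻¹) C) :
    C.card ≤ 2 ^ ∑ j ∈ Finset.range k, (A j).card := by
  classical
  choose! ε hε hεc using hC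
  set T : Finset (Σ _ : ℕ, Fin d) := (Finset.range k).sigma A with hT
  rw [← Finset.card_sigma, ← Finset.card_powerset]
  refine Finset.card_le_card_of_injOn (fun c => {t ∈ T | ε c t.2 t.1 = 1})
    (fun c _ => Finset.mem_powerset.2 (Finset.filter_subset _ _)) fun c hc c' hc' he => ?_
  by_contra hne
  have h1 := hsep hc hc' hne
  refine absurd h1 (not_lt.2 (dist_le_two_pow_mul (by positivity) fun i => ?_))
  have e1 : c i - c' i = ofBinary (ε c) i - ofBinary (ε c') i := by
    rw [hεc c hc, hεc c' hc', PiLp.add_apply, PiLp.add_apply]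
    ring
  rw [e1]
  have := Real.abs_ofDigits_sub_ofDigits_le (x := ε c i) (y := ε c' i) (n := k) fun j hj => by
    by_cases hi : i ∈ A j
    · have hmem : (⟨j, i⟩ : Σ _ : ℕ, Fin d) ∈ T := by simp [hT, hj, hi]
      have := Finset.ext_iff.1 he ⟨j, i⟩
      simp only [Finset.mem_filter, hmem, true_and] at this
      generalize ε c i j = a at *
      generalize ε c' i j = b at *
      fin_cases a <;> fin_cases b <;> simp at this ⊢
    · rw [hε c hc i j hi, hε c' hc' i j hi]
  exact_mod_cast this

end digitSet

/-! ### Part (ii): the union of homogeneous pieces accumulating at the origin. -/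

section inhomogeneous

variable {d : ℕ} {f : ℝ → ℝ → ℝ}

/-- The coordinates whose `j`-th binary digit is free in the homogeneous set with branching
function `f · n`. -/
noncomputable def freeCoords (d : ℕ) (f : ℝ → ℝ → ℝ) (n j : ℕ) : Finset (Fin d) :=
  if n ≤ j then Finset.univ.filter fun i => (i : ℕ) < ⌊f (j + 1 : ℕ) n⌋₊ - ⌊f j n⌋₊ else ∅

theorem freeCoords_of_lt {n j : ℕ} (h : j < n) : freeCoords d f n j = ∅ :=
  if_neg (not_le.2 h)

theorem MemL.floor_le_floor (hf : MemL (d : ℝ≥0) f) {n m k : ℕ} (hnm : n ≤ m) (hmk : m ≤ k) :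
    ⌊f m n⌋₊ ≤ ⌊f k n⌋₊ :=
  Nat.floor_le_floor (hf.mono (by exact_mod_cast hnm) (by exact_mod_cast hmk))

/-- The `d`-Lipschitz condition bounds the floor increments by d, so there are enough coordinates to
realise them. -/
theorem card_freeCoords (hf : MemL (d : ℝ≥0) f) {n j : ℕ} (h : n ≤ j) :
    (freeCoords d f n j).card = ⌊f (j + 1 : ℕ) n⌋₊ - ⌊f j n⌋₊ := by
  rw [freeCoords, if_pos h]
  refine Fin.card_filter_val_lt.trans (min_eq_right ?_)
  have h1 := hf.le_add (u := (j + 1 : ℕ)) (w := j) (v := n) (by exact_mod_cast h) (by simp)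
  have h2 : ⌊f (j + 1 : ℕ) n⌋₊ ≤ ⌊f j n⌋₊ + d := by
    rw [← Nat.floor_add_natCast (hf.nonneg _ _ (by exact_mod_cast h))]
    refine Nat.floor_le_floor (h1.trans ?_)
    simp
  omega

theorem sum_card_freeCoords (hf : MemL (d : ℝ≥0) f) {n k : ℕ} (h : n ≤ k) :
    ∑ j ∈ Finset.range k, (freeCoords d f n j).card = ⌊f k n⌋₊ := by
  induction k, h using Nat.le_induction with
  | base =>
    rw [hf.diag, Nat.floor_zero]
    exact Finset.sum_eq_zero fun j hj => by simp [freeCoords_of_lt (Finset.mem_range.1 hj)]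
  | succ k hk ih =>
    have := hf.floor_le_floor hk k.le_succ
    rw [Finset.sum_range_succ, ih, card_freeCoords hf hk]
    exact Nat.add_sub_cancel' this

/-- The vector all of whose coordinates are `3 * 2 ^ (-n)`. -/
noncomputable def cornerShift (d n : ℕ) : EuclideanSpace ℝ (Fin d) :=
  WithLp.toLp 2 fun _ => 3 * ((2 : ℝ) ^ n)⁻¹

@[simp]
theorem cornerShift_apply (n : ℕ) (i : Fin d) : cornerShift d n i = 3 * ((2 : ℝ) ^ n)⁻¹ := rfl

/-- A homogeneous set with branching function `f · 0` in the unit cube, together with, for every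
`n`, a homogeneous set with branching function `f · n` in a cube of side `2 ^ (-n)` which lies
in the opposite orthant at distance about `2 ^ (-n)` from the origin. -/
def cornerUnion (d : ℕ) (f : ℝ → ℝ → ℝ) : Set (EuclideanSpace ℝ (Fin d)) :=
  {x | x ∈ digitSet (freeCoords d f 0) ∨ ∃ n, x + cornerShift d n ∈ digitSet (freeCoords d f n)}

theorem zero_mem_cornerUnion : 0 ∈ cornerUnion d f :=
  Or.inl (zero_mem_digitSet _)

theorem apply_mem_Icc_of_add_cornerShift_mem {n : ℕ} {x : EuclideanSpace ℝ (Fin d)}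
    (hx : x + cornerShift d n ∈ digitSet (freeCoords d f n)) (i : Fin d) :
    -3 * ((2 : ℝ) ^ n)⁻¹ ≤ x i ∧ x i ≤ -2 * ((2 : ℝ) ^ n)⁻¹ := by
  have h1 := nonneg_of_mem_digitSet hx i
  have h2 := le_of_mem_digitSet (n := n) (fun j hj => freeCoords_of_lt hj) hx i
  rw [PiLp.add_apply, cornerShift_apply] at h1 h2
  constructor <;> linarith

theorem dist_zero_le_of_add_cornerShift_mem {n : ℕ} {x : EuclideanSpace ℝ (Fin d)}
    (hx : x + cornerShift d n ∈ digitSet (freeCoords d f n)) :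
    dist x 0 ≤ 2 ^ d * (3 * ((2 : ℝ) ^ n)⁻¹) := by
  refine dist_le_two_pow_mul (by positivity) fun i => ?_
  have h := apply_mem_Icc_of_add_cornerShift_mem hx i
  have hpos : (0 : ℝ) < ((2 : ℝ) ^ n)⁻¹ := by positivity
  rw [PiLp.zero_apply, sub_zero, abs_le]
  constructor <;> linarith

theorem inv_two_pow_anti {m n : ℕ} (h : m ≤ n) : ((2 : ℝ) ^ n)⁻¹ ≤ ((2 : ℝ) ^ m)⁻¹ := by
  gcongr
  norm_num

/-- The pieces shrink to 0, which belongs to the set: it is the intersection of the compact sets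
formed by finitely many pieces and a small ball that absorbs the others. -/
theorem isCompact_cornerUnion : IsCompact (cornerUnion d f) := by
  let K : ℕ → Set (EuclideanSpace ℝ (Fin d)) := fun N =>
    digitSet (freeCoords d f 0) ∪
      (⋃ n ∈ Finset.range N, (fun x => x + cornerShift d n) ⁻¹' digitSet (freeCoords d f n)) ∪
        Metric.closedBall 0 (2 ^ d * (3 * ((2 : ℝ) ^ N)⁻¹))
  have hK : ∀ N, IsCompact (K N) := fun N =>
    ((isCompact_digitSet _).union (Finset.isCompact_biUnion _ fun n _ =>
      (Homeomorph.addRight (cornerShift d n)).isCompact_preimage.2 (isCompact_digitSet _))).union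
        (isCompact_closedBall _ _)
  have hX : cornerUnion d f = ⋂ N, K N := by
    ext x
    simp only [Set.mem_iInter]
    constructor
    · rintro (hx | ⟨n, hx⟩) N
      · exact Or.inl (Or.inl hx)
      · by_cases hn : n < N
        · exact Or.inl (Or.inr (Set.mem_biUnion (Finset.mem_range.2 hn) hx))
        · refine Or.inr ((dist_zero_le_of_add_cornerShift_mem hx).trans ?_)
          have := inv_two_pow_anti (not_lt.1 hn)
          gcongr
    · intro h
      by_cases hx0 : x = 0
      · rw [hx0]
        exact zero_mem_cornerUnion
      · have ht : Filter.Tendsto (fun N : ℕ => 2 ^ d * (3 * ((2 : ℝ) ^ N)⁻¹)) Filter.atTop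
            (nhds 0) := by
          have := (tendsto_pow_atTop_nhds_zero_of_lt_one (r := (2 : ℝ)⁻¹) (by norm_num)
            (by norm_num)).const_mul ((2 : ℝ) ^ d * 3)
          simpa [mul_assoc] using this
        obtain ⟨N, hN⟩ := (ht.eventually_lt_const (dist_pos.2 hx0)).exists
        rcases h N with (hx | hx) | hx
        · exact Or.inl hx
        · obtain ⟨n, _, hx⟩ := Set.mem_iUnion₂.1 hx
          exact Or.inr ⟨n, hx⟩
        · exact absurd hN (not_lt.2 hx)
  rw [hX]
  exact (hK 0).of_isClosed_subset (isClosed_iInter fun N => (hK N).isClosed)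
    (Set.iInter_subset K 0)

/-- In units of `2 ^ (-n)`, the coordinates of x lie in `(-4, -2)`. Larger pieces lie at or below
-4, smaller ones at or above -3/2, and the central set is nonnegative. -/
theorem add_cornerShift_mem_of_dist_lt {n : ℕ} {x : EuclideanSpace ℝ (Fin d)}
    (hx : x ∈ cornerUnion d f) (h : dist x (-cornerShift d n) < ((2 : ℝ) ^ n)⁻¹) :
    x + cornerShift d n ∈ digitSet (freeCoords d f n) := by
  -- For `d = 0` no coordinate tells the pieces apart, but the space is a point.
  rcases isEmpty_or_nonempty (Fin d) with he | ⟨⟨i⟩⟩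
  · rw [Subsingleton.elim (x + cornerShift d n) 0]
    exact zero_mem_digitSet _
  have hi := (abs_sub_apply_le_dist x (-cornerShift d n) i).trans_lt h
  rw [PiLp.neg_apply, cornerShift_apply, abs_lt] at hi
  have hpos : (0 : ℝ) < ((2 : ℝ) ^ n)⁻¹ := by positivity
  rcases hx with hx | ⟨m, hx⟩
  · have := nonneg_of_mem_digitSet hx i
    linarith
  · have hb := apply_mem_Icc_of_add_cornerShift_mem hx i
    rcases lt_trichotomy m n with hmn | rfl | hmn
    · have := inv_two_pow_anti (Nat.succ_le_of_lt hmn)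
      rw [pow_succ, mul_inv] at this
      linarith
    · exact hx
    · have := inv_two_pow_anti (Nat.succ_le_of_lt hmn)
      rw [pow_succ, mul_inv] at this
      linarith

theorem neg_cornerShift_mem (n : ℕ) : -cornerShift d n ∈ cornerUnion d f :=
  Or.inr ⟨n, by rw [neg_add_cancel]; exact zero_mem_digitSet _⟩

/-- A point of a piece with `n ≤ m` is handled inside that piece. If `n > m`, the point is within 3
units of `2 ^ (-m)` of 0 in each coordinate, and the central set around 0 serves instead; hence the
4. -/
theorem exists_finset_cornerUnion {x : EuclideanSpace ℝ (Fin d)} (hx : x ∈ cornerUnion d f)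
    (m k : ℕ) :
    ∃ n ≤ m, ∃ C : Finset (EuclideanSpace ℝ (Fin d)),
      (∀ c ∈ C, c ∈ cornerUnion d f ∧ dist c x ≤ 2 ^ d * (4 * ((2 : ℝ) ^ m)⁻¹)) ∧
      (∀ c ∈ C, ∀ c' ∈ C, c ≠ c' → ((2 : ℝ) ^ k)⁻¹ ≤ dist c c') ∧
      C.card = 2 ^ ∑ j ∈ Finset.Ico m k, (freeCoords d f n j).card := by
  have hpos : (0 : ℝ) < ((2 : ℝ) ^ m)⁻¹ := by positivity
  have key : ∀ y ∈ digitSet (freeCoords d f 0), (∀ i, |y i - x i| ≤ 3 * ((2 : ℝ) ^ m)⁻¹) →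
      ∃ n ≤ m, ∃ C : Finset (EuclideanSpace ℝ (Fin d)),
      (∀ c ∈ C, c ∈ cornerUnion d f ∧ dist c x ≤ 2 ^ d * (4 * ((2 : ℝ) ^ m)⁻¹)) ∧
      (∀ c ∈ C, ∀ c' ∈ C, c ≠ c' → ((2 : ℝ) ^ k)⁻¹ ≤ dist c c') ∧
      C.card = 2 ^ ∑ j ∈ Finset.Ico m k, (freeCoords d f n j).card := by
    intro y hy hyx
    obtain ⟨C, hC, hsep, hcard⟩ := exists_finset_digitSet (freeCoords d f 0) (x := y) (p := 0)
      (by rwa [add_zero]) m k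
    refine ⟨0, m.zero_le, C, fun c hc => ⟨Or.inl ?_, ?_⟩, hsep, hcard⟩
    · simpa using (hC c hc).1
    · refine dist_le_two_pow_mul (by positivity) fun i => ?_
      have h1 := (hC c hc).2 i
      have h2 := hyx i
      have h3 := abs_sub_le (c i) (y i) (x i)
      linarith
  rcases hx with hx | ⟨n, hx⟩
  · exact key x hx fun i => by rw [sub_self, abs_zero]; positivity
  rcases le_total n m with hnm | hmn
  · obtain ⟨C, hC, hsep, hcard⟩ := exists_finset_digitSet _ hx m k
    refine ⟨n, hnm, C, fun c hc => ⟨Or.inr ⟨n, (hC c hc).1⟩, ?_⟩, hsep, hcard⟩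
    exact dist_le_two_pow_mul (by positivity) fun i => ((hC c hc).2 i).trans (by linarith)
  · refine key 0 (zero_mem_digitSet _) fun i => ?_
    have h1 := apply_mem_Icc_of_add_cornerShift_mem hx i
    have h2 := inv_two_pow_anti hmn
    have h3 : (0 : ℝ) < ((2 : ℝ) ^ n)⁻¹ := by positivity
    rw [PiLp.zero_apply, zero_sub, abs_neg, abs_le]
    constructor <;> linarith

theorem two_pow_mul_inv_two_pow (a k : ℕ) :
    (2 : ℝ) ^ a * ((2 : ℝ) ^ k)⁻¹ = (2 : ℝ) ^ ((a : ℝ) - k) := by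
  rw [Real.rpow_sub (by norm_num), Real.rpow_natCast, Real.rpow_natCast, div_eq_mul_inv]

theorem le_branching_cornerUnion (hf : MemL (d : ℝ≥0) f) {u v : ℝ} (hv : 0 ≤ v)
    (huv : v + (d + 7) ≤ u) :
    f u (v + (d + 3)) - (4 * d + 1) ≤ branching (cornerUnion d f) u v := by
  have hd : (0 : ℝ) ≤ d := d.cast_nonneg
  -- These choices ensure `2 ^ d * 4 * 2 ^ (-m) ≤ 2 ^ (-v)` and, for k, the strict inequality `4 * 2
  -- ^ (-u) < 2 ^ (-k)`.
  set m : ℕ := ⌈v⌉₊ + d + 2 with hm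
  set k : ℕ := ⌊u⌋₊ - 3 with hk
  have hmv : (m : ℝ) ≤ v + (d + 3) := by
    have := Nat.ceil_lt_add_one hv
    rw [hm]
    push_cast
    linarith
  have hmv' : v + d + 2 ≤ m := by
    have := Nat.le_ceil v
    rw [hm]
    push_cast
    linarith
  have hu3 : 3 ≤ ⌊u⌋₊ := Nat.le_floor (by push_cast; linarith)
  have hku : (k : ℝ) + 3 ≤ u := by
    rw [hk, Nat.cast_sub hu3]
    have := Nat.floor_le (show 0 ≤ u by linarith)
    push_cast
    linarith
  have hku' : u - 4 ≤ k := by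
    rw [hk, Nat.cast_sub hu3]
    have := Nat.lt_floor_add_one u
    push_cast
    linarith
  have hmk : m ≤ k := by
    have : (m : ℝ) ≤ k := by linarith
    exact_mod_cast this
  have hX : (cornerUnion d f).Nonempty := ⟨0, zero_mem_cornerUnion⟩
  apply le_branching_of_rpow_le hX
  obtain ⟨x, hx, hmax⟩ := exists_forall_card_le hX u v
  obtain ⟨n, hnm, C, hC, hsep, hcard⟩ := exists_finset_cornerUnion hx m k
  have hle := hmax C (fun c hc => ⟨(hC c hc).1, (hC c hc).2.trans ?_⟩) ?_
  -- Superadditivity removes the unknown n: `f k n - f m n ≥ f k m`. The floors cost at most 1, and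
  -- replacing k by u costs at most 4d.
  · have hsum : ∑ j ∈ Finset.Ico m k, (freeCoords d f n j).card = ⌊f k n⌋₊ - ⌊f m n⌋₊ := by
      have := Finset.sum_range_add_sum_Ico (fun j => (freeCoords d f n j).card) hmk
      rw [sum_card_freeCoords hf hnm, sum_card_freeCoords hf (hnm.trans hmk)] at this
      omega
    rw [hcard, hsum] at hle
    refine le_trans ?_ (Nat.cast_le.2 hle)
    rw [Nat.cast_pow, Nat.cast_ofNat, ← Real.rpow_natCast]
    refine Real.rpow_le_rpow_of_exponent_le (by norm_num) ?_
    rw [Nat.cast_sub (hf.floor_le_floor hnm hmk)]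
    have hnm' : (n : ℝ) ≤ m := by exact_mod_cast hnm
    have hmk' : (m : ℝ) ≤ k := by exact_mod_cast hmk
    have h1 := Nat.lt_floor_add_one (f k n)
    have h2 := Nat.floor_le (hf.nonneg m n hnm')
    have h3 := hf.superadd k m n hnm' hmk'
    have h4 := hf.le_add hmk' (show (k : ℝ) ≤ u by linarith)
    have h5 := hf.anti hmv (show v + (d + 3) ≤ u by linarith)
    have h6 := mul_le_mul_of_nonneg_left (show u - k ≤ 4 by linarith) hd
    push_cast at h4
    linarith
  · rw [← mul_assoc, show (2 : ℝ) ^ d * 4 = 2 ^ (d + 2) by ring, two_pow_mul_inv_two_pow]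
    refine Real.rpow_le_rpow_of_exponent_le (by norm_num) ?_
    push_cast
    linarith
  · intro c hc c' hc' hne
    refine lt_of_lt_of_le ?_ (hsep c hc c' hc' hne)
    have e := two_pow_mul_inv_two_pow 0 k
    rw [pow_zero, one_mul] at e
    rw [e, show (4 : ℝ) = 2 ^ (2 : ℝ) by norm_num, ← Real.rpow_add (by norm_num)]
    refine Real.rpow_lt_rpow_of_exponent_lt (by norm_num) ?_
    push_cast
    linarith

theorem branching_cornerUnion_le (hf : MemL (d : ℝ≥0) f) {u v : ℝ} (hv : 1 ≤ v) (hvu : v ≤ u) :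
    branching (cornerUnion d f) u v ≤ f u (v - 2) + d * (d + 1) := by
  have hd : (0 : ℝ) ≤ d := d.cast_nonneg
  -- Subtracting 1 makes `2 ^ (-v) < 2 ^ (-n)` strict, so the ball about the corner sees piece n
  -- only; k absorbs the factor `2 ^ d`.
  set n : ℕ := ⌊v⌋₊ - 1 with hn
  set k : ℕ := ⌈u⌉₊ + d with hk
  have h1v : 1 ≤ ⌊v⌋₊ := Nat.le_floor (by push_cast; exact hv)
  have hnv : (n : ℝ) + 1 ≤ v := by
    rw [hn, Nat.cast_sub h1v]
    have := Nat.floor_le (show 0 ≤ v by linarith)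
    push_cast
    linarith
  have hnv' : v - 2 ≤ n := by
    rw [hn, Nat.cast_sub h1v]
    have := Nat.lt_floor_add_one v
    push_cast
    linarith
  have hku : u + d ≤ k := by
    rw [hk]
    have := Nat.le_ceil u
    push_cast
    linarith
  have hku' : (k : ℝ) ≤ u + (d + 1) := by
    rw [hk]
    have := Nat.ceil_lt_add_one (show 0 ≤ u by linarith)
    push_cast
    linarith
  have hnk : n ≤ k := by
    have : (n : ℝ) ≤ k := by linarith
    exact_mod_cast this
  obtain ⟨C, hC, hsep, hcard⟩ :=
    exists_separated_card_eq (neg_cornerShift_mem (d := d) (f := f) n) u v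
  have hle := card_le_of_subset_digitSet (freeCoords d f n) (p := cornerShift d n) (C := C)
    (k := k) (fun c hc => add_cornerShift_mem_of_dist_lt (hC c hc).1
      ((hC c hc).2.trans_lt ?_)) (hsep.mono ?_)
  · rw [sum_card_freeCoords hf hnk, hcard] at hle
    apply branching_le_of_le_rpow ⟨0, zero_mem_cornerUnion⟩
    refine (Nat.cast_le.2 hle).trans ?_
    rw [Nat.cast_pow, Nat.cast_ofNat, ← Real.rpow_natCast]
    refine Real.rpow_le_rpow_of_exponent_le (by norm_num) ?_
    have hnu : (n : ℝ) ≤ u := by linarith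
    have h1 := Nat.floor_le (hf.nonneg k n (by exact_mod_cast hnk))
    have h2 := hf.le_add hnu (show u ≤ k by linarith)
    have h3 := hf.anti hnv' hnu
    have h4 := mul_le_mul_of_nonneg_left (show k - u ≤ d + 1 by linarith) hd
    push_cast at h2
    linarith
  · have e := two_pow_mul_inv_two_pow 0 n
    rw [pow_zero, one_mul] at e
    rw [e]
    refine Real.rpow_lt_rpow_of_exponent_lt (by norm_num) ?_
    push_cast
    linarith
  · rw [two_pow_mul_inv_two_pow, show (4 : ℝ) = 2 ^ (2 : ℝ) by norm_num,
      ← Real.rpow_add (by norm_num)]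
    refine Real.rpow_le_rpow_of_exponent_le (by norm_num) ?_
    linarith

theorem simWith_cornerUnion (hf : MemL (d : ℝ≥0) f) :
    SimWith (d * (d + 1) + 4 * d + 7) (fun u v => (f u v : EReal))
      (lowerBranching (cornerUnion d f)) := by
  have hd : (0 : ℝ) ≤ d := d.cast_nonneg
  have hd2 : (0 : ℝ) ≤ d * (d + 1) := by positivity
  have hX : (cornerUnion d f).Nonempty := ⟨0, zero_mem_cornerUnion⟩
  refine ⟨?_, ?_, ?_, ?_⟩
  · intro u v h
    exact ⟨EReal.coe_nonneg.2 (hf.nonneg u v h), EReal.coe_lt_top _⟩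
  · intro u v h
    rw [lowerBranching_eq hX]
    exact ⟨EReal.coe_nonneg.2 (branching_nonneg _ u v), EReal.coe_lt_top _⟩
  · intro u v hv _ h
    rw [lowerBranching_eq hX, ← EReal.coe_sub, EReal.coe_le_coe_iff]
    have h1 := le_branching_cornerUnion hf hv (show v + (d + 7) ≤ u by linarith)
    have h2 := hf.anti (show v + (d + 3) ≤ v + (d * (d + 1) + 4 * d + 7) by linarith)
      (show v + (d * (d + 1) + 4 * d + 7) ≤ u by linarith)
    linarith
  · intro u v _ hvu h
    rw [lowerBranching_eq hX, ← EReal.coe_add, EReal.coe_le_coe_iff]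
    have h1 := branching_cornerUnion_le hf (show 1 ≤ v by linarith) hvu
    have h2 := hf.anti (show v - (d * (d + 1) + 4 * d + 7) ≤ v - 2 by linarith)
      (show v - 2 ≤ u by linarith)
    linarith

end inhomogeneous

theorem theoremB (d : ℕ) :
    (∃ z : ℝ, 0 ≤ z ∧
      ∀ X : Set (EuclideanSpace ℝ (Fin d)), X.Nonempty →
        ∃ f : ℝ → ℝ → ℝ, MemL (d : ℝ≥0) f ∧
          SimWith z (fun u v => (f u v : EReal)) (lowerBranching X)) ∧
    (∃ z : ℝ, 0 ≤ z ∧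
      ∀ f : ℝ → ℝ → ℝ, MemL (d : ℝ≥0) f →
        ∃ X : Set (EuclideanSpace ℝ (Fin d)), X.Nonempty ∧ IsCompact X ∧
          SimWith z (fun u v => (f u v : EReal)) (lowerBranching X)) := by
  refine ⟨⟨6 * d + 1, by positivity, fun X hX => exists_memL_simWith hX⟩,
    ⟨d * (d + 1) + 4 * d + 7, by positivity, fun f hf => ⟨cornerUnion d f,
      ⟨0, zero_mem_cornerUnion⟩, isCompact_cornerUnion, simWith_cornerUnion hf⟩⟩⟩
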